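/- **Setting.** A bilinear rule $\langle U,V,W\rangle$ of rank $R$ for positive dimensions $\langle M_0,K_0,N_0\rangle$ consists of real matrices $U\in\mathbb R^{M_0K_0\times R}$, $V\in\mathbb R^{K_0N_0\times R}$, $W\in\mathbb R^{M_0N_0\times R}$ (rows indexed by the entry positions of the two factors and of the product) such that for all real $A$ ($M_0\times K_0$) and $B$ ($K_0\times N_0$), the product $C=AB$ has the entries $c_k=\sum_{r=1}^R w_{kr}\bigl(\sum_i u_{ir}a_i\bigr)\bigl(\sum_j v_{jr}b_j\bigr)$. Let $\alpha_r,\beta_r$ be the numbers of nonzeros in column $r$ of $U$ and of $V$, let $\gamma_k$ be the number of nonzeros in row $k$ of $W$, and put $$Q=\max_k\Bigl(\gamma_k+\max_r(\alpha_r+\beta_r)\,\mathbb I(w_{kr}\ne0)\Bigr),\qquad E=\max_k\sum_{r=1}^R\Bigl(\sum_i|u_{ir}|\Bigr)\Bigl(\sum_j|v_{jr}|\Bigr)|w_{kr}|.$$ Let $L\ge 0$ and, for $l=1,\dots,L$, let $\langle U^{[l]},V^{[l]},W^{[l]}\rangle$ be a bilinear rule for dimensions $\langle M_0^{[l]},K_0^{[l]},N_0^{[l]}\rangle$,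 with the quantities $Q^{[l]}$, $E^{[l]}$. Let $\prod_l M_0^{[l]}$, $\prod_l K_0^{[l]}$, $\prod_l N_0^{[l]}$ divide $M$, $K$, $N$, respectively. The uniform, non-stationary algorithm multiplies an $M\times K$ matrix $A$ by a $K\times N$ matrix $B$ recursively: at level $l$ the current factors are cut into $M_0^{[l]}\times K_0^{[l]}$ and $K_0^{[l]}\times N_0^{[l]}$ blocks $A_i$, $B_j$ of equal size; one forms $S_r=\sum_i u^{[l]}_{ir}A_i$ and $T_r=\sum_j v^{[l]}_{jr}B_j$, computes the products $M_r=S_rT_r$ by the algorithm of level $l+1$ (the classical algorithm, if $l=L$), and forms the blocks $C_k=\sum_r w^{[l]}_{kr}M_r$ of the result. Arithmetic is rounded: every scalar operation with exact result $x$ returns $x(1+\theta)$ for some $|\theta|<\epsilon$. In a linear combination with coefficients from $U^{[l]}$, $V^{[l]}$ or $W^{[l]}$, the terms with nonzero coefficient are multiplied by it and accumulated one at a time, in any order; the classical algorithm accumulates the products of each inner product one at a time, in any order. Let $\|\cdot\|$ be the max-norm. **Theorem.** There is a constant $c$, depending only on $M,K,N$ and the rules $\langle U^{[l]},V^{[l]},W^{[l]}\rangle$,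 such that for all $0<\epsilon<1$, all $A\in\mathbb R^{M\times K}$, $B\in\mathbb R^{K\times N}$, $C=AB$, and every possible computed result $\hat C$ of this algorithm, $$\|\hat C-C\|\le\left(\frac{K}{\prod_{l=1}^LK_0^{[l]}}+\sum_{l=1}^LQ^{[l]}\right)\left(\frac{K}{\prod_{l=1}^LK_0^{[l]}}\right)\left(\prod_{l=1}^LE^{[l]}\right)\|A\|\,\|B\|\,\epsilon+c\,\|A\|\,\|B\|\,\epsilon^2 .$$ -/

import Mathlib

open scoped Matrix.Norms.Elementwise

noncomputable section

namespace FastMM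

/-! ### Rounded arithmetic -/

/-- `y` is a possible computed value of an operation with exact result `x`:
`y = x (1 + θ)` for some `|θ| < ε`. -/
def IsRounded (ε x y : ℝ) : Prop :=
  ∃ θ : ℝ, |θ| < ε ∧ y = x * (1 + θ)

/-- `IsFlSum ε c a s y`: the value `y` is a possible result of evaluating `∑ i ∈ s, c i * a i` in
rounded arithmetic, by accumulating the rounded products one at a time (the first product is the
initial value of the accumulator). The terms may be taken in any order. -/
inductive IsFlSum {ι : Type} (ε : ℝ) (c a : ι → ℝ) : Finset ι → ℝ → Prop
  | empty : IsFlSum ε c a ∅ 0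
  | singleton (i : ι) (p : ℝ) (hp : IsRounded ε (c i * a i) p) : IsFlSum ε c a {i} p
  | cons (i : ι) (s : Finset ι) (hi : i ∉ s) (hs : s.Nonempty) (y p z : ℝ)
      (hy : IsFlSum ε c a s y) (hp : IsRounded ε (c i * a i) p) (hz : IsRounded ε (y + p) z) :
      IsFlSum ε c a (Finset.cons i s hi) z

open Classical in
/-- `y` is a possible computed value of the linear combination `∑ i, c i * a i` with fixed
coefficients `c`; only the terms with nonzero coefficient are formed and accumulated. -/
def IsFlLinComb {ι : Type} [Fintype ι] (ε : ℝ) (c a : ι → ℝ) (y : ℝ) : Prop :=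
  IsFlSum ε c a (Finset.univ.filter fun i => c i ≠ 0) y

/-- `C` is a possible result of multiplying `A` and `B` by the classical algorithm in rounded
arithmetic. -/
def IsFlClassicalMul {M K N : ℕ} (ε : ℝ) (A : Matrix (Fin M) (Fin K) ℝ)
    (B : Matrix (Fin K) (Fin N) ℝ) (C : Matrix (Fin M) (Fin N) ℝ) : Prop :=
  ∀ i j, IsFlSum ε (fun k => A i k) (fun k => B k j) Finset.univ (C i j)

/-! ### Bilinear rules and their principal quantities -/

/-- The data `⟨U, V, W⟩` of a bilinear rule of rank `R` for the dimensions `⟨M₀, K₀, N₀⟩`.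
The rows of `U`, `V`, `W` are indexed by the positions of the entries (or blocks) of the two factors
and of the product, as pairs (row, column) instead of their number in a column- or row-major
enumeration. -/
structure Rule where
  M₀ : ℕ
  K₀ : ℕ
  N₀ : ℕ
  R : ℕ
  M₀_pos : 0 < M₀
  K₀_pos : 0 < K₀
  N₀_pos : 0 < N₀
  U : Matrix (Fin M₀ × Fin K₀) (Fin R) ℝ
  V : Matrix (Fin K₀ × Fin N₀) (Fin R) ℝ
  W : Matrix (Fin M₀ × Fin N₀) (Fin R) ℝ

namespace Rule

/-- In exact arithmetic, the rule computes the product of an `M₀ × K₀` and a `K₀ × N₀` matrix. -/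
def ComputesProduct (f : Rule) : Prop :=
  ∀ (A : Matrix (Fin f.M₀) (Fin f.K₀) ℝ) (B : Matrix (Fin f.K₀) (Fin f.N₀) ℝ)
    (k : Fin f.M₀ × Fin f.N₀),
    (A * B) k.1 k.2 =
      ∑ r, f.W k r * ((∑ i, f.U i r * A i.1 i.2) * (∑ j, f.V j r * B j.1 j.2))

open Classical in
/-- number of nonzeros in column `r` of `U` -/
def alpha (f : Rule) (r : Fin f.R) : ℕ := ∑ i, if f.U i r ≠ 0 then 1 else 0

open Classical in
/-- number of nonzeros in column `r` of `V` -/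
def beta (f : Rule) (r : Fin f.R) : ℕ := ∑ j, if f.V j r ≠ 0 then 1 else 0

open Classical in
/-- number of nonzeros in row `k` of `W` -/
def gamma (f : Rule) (k : Fin f.M₀ × Fin f.N₀) : ℕ := ∑ r, if f.W k r ≠ 0 then 1 else 0

/-- 1-norm of column `r` of `U` -/
def a (f : Rule) (r : Fin f.R) : ℝ := ∑ i, |f.U i r|

/-- 1-norm of column `r` of `V` -/
def b (f : Rule) (r : Fin f.R) : ℝ := ∑ j, |f.V j r|

open Classical in
/-- the prefactor vector `q` -/
def q (f : Rule) (k : Fin f.M₀ × Fin f.N₀) : ℕ :=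
  f.gamma k +
    Finset.univ.sup fun r => (f.alpha r + f.beta r) * (if f.W k r ≠ 0 then 1 else 0)

/-- the prefactor `Q = max_k q_k` -/
def Q (f : Rule) : ℕ := Finset.univ.sup f.q

/-- the stability vector `e` -/
def e (f : Rule) (k : Fin f.M₀ × Fin f.N₀) : ℝ := ∑ r, f.a r * f.b r * |f.W k r|

/-- the stability factor `E = max_k e_k` (a maximum over a finite nonempty index set) -/
def E (f : Rule) : ℝ := ⨆ k, f.e k

end Rule

/-! ### The recursive algorithm -/

/-- Position `p` inside block number `i`, when `Fin n` is cut into `n₀` consecutive blocks of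
length `n / n₀`. -/
def blockIdx {n n₀ : ℕ} (i : Fin n₀) (p : Fin (n / n₀)) : Fin n :=
  ⟨i * (n / n₀) + p, by
    calc (i : ℕ) * (n / n₀) + p < i * (n / n₀) + n / n₀ := Nat.add_lt_add_left p.2 _
      _ = (i + 1) * (n / n₀) := by ring
      _ ≤ n₀ * (n / n₀) := Nat.mul_le_mul_right _ i.2
      _ ≤ n := Nat.mul_div_le n n₀⟩

/-- Block `i` (a pair: block row, block column) of `A` cut into `m₀ × k₀` blocks of size
`(M / m₀) × (K / k₀)`. -/
def block {M K m₀ k₀ : ℕ} (A : Matrix (Fin M) (Fin K) ℝ) (i : Fin m₀ × Fin k₀) :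
    Matrix (Fin (M / m₀)) (Fin (K / k₀)) ℝ :=
  fun p p' => A (blockIdx i.1 p) (blockIdx i.2 p')

/-- `IsComputed ε L alg M K N A B C`: the matrix `C` is a possible result of multiplying the
`M × K` matrix `A` and the `K × N` matrix `B` in rounded arithmetic by the uniform, non-stationary
algorithm with `L` recursive steps that uses the rule `alg 0` at the first level, `alg 1` at the
second one, and so on, and the classical algorithm after the last level. -/
def IsComputed (ε : ℝ) : (L : ℕ) → (Fin L → Rule) → (M K N : ℕ) →
    Matrix (Fin M) (Fin K) ℝ → Matrix (Fin K) (Fin N) ℝ → Matrix (Fin M) (Fin N) ℝ → Prop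
  | 0, _, _, _, _, A, B, C => IsFlClassicalMul ε A B C
  | L + 1, alg, M, K, N, A, B, C =>
    ∃ (S : Fin (alg 0).R → Matrix (Fin (M / (alg 0).M₀)) (Fin (K / (alg 0).K₀)) ℝ)
      (T : Fin (alg 0).R → Matrix (Fin (K / (alg 0).K₀)) (Fin (N / (alg 0).N₀)) ℝ)
      (P : Fin (alg 0).R → Matrix (Fin (M / (alg 0).M₀)) (Fin (N / (alg 0).N₀)) ℝ),
      (∀ r x y, IsFlLinComb ε (fun i => (alg 0).U i r) (fun i => block A i x y) (S r x y)) ∧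
      (∀ r x y, IsFlLinComb ε (fun j => (alg 0).V j r) (fun j => block B j x y) (T r x y)) ∧
      (∀ r, IsComputed ε L (fun l => alg l.succ) _ _ _ (S r) (T r) (P r)) ∧
      (∀ k x y, IsFlLinComb ε (fun r => (alg 0).W k r) (fun r => P r x y) (block C k x y))

end FastMM

end

namespace FastMM

/-! ### Rounding errors of sums and linear combinations -/

/-! Errors are kept in the form `|ŷ - y| ≤ ((1 + ε) ^ m - 1) * g` with `|y| ≤ g`. In this form
exponents simply add, both through rounded linear combinations and through products, so no
higher-order term is dropped before the end.

In one recursive level, forming the factors contributes `α_r + β_r` to the exponent, the recursive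
product contributes the exponent `D` of the remaining levels, and the combination by `W` contributes
`γ_k`. The maximum over the `r` used by `k`, and then over `k`, gives `Q`. The magnitudes `g` grow
by `e_k ≤ E` (`IsComputed.error_le`).

The recursive call sees rounded factors, so its error must be combined with that of their exact
product. The latter carries the inner dimension `K / K₀`, the former the factor `F` of the remaining
levels; they merge because `K / K₀ ≤ F`, which rests on `K₀ ≤ E` for every correct rule
(`Rule.K₀_le_E`, `K_div_le`). Expanding `(1 + ε) ^ n - 1` to first order finishes the proof. -/

theorem IsRounded.error_le {ε x y : ℝ} (h : IsRounded ε x y) : |y - x| ≤ ε * |x| := by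
  obtain ⟨θ, hθ, rfl⟩ := h
  have : x * (1 + θ) - x = θ * x := by ring
  rw [this, abs_mul]
  gcongr

theorem one_le_one_add_pow {ε : ℝ} (hε : 0 ≤ ε) (n : ℕ) : 1 ≤ (1 + ε) ^ n :=
  one_le_pow₀ (by linarith)

/-- Each term passes through one multiplication and at most `s.card - 1` additions, whatever the
order. -/
theorem IsFlSum.error_le {ι : Type} {ε : ℝ} (hε : 0 ≤ ε) {c a : ι → ℝ} {s : Finset ι} {y : ℝ}
    (h : IsFlSum ε c a s y) :
    |y - ∑ i ∈ s, c i * a i| ≤ ((1 + ε) ^ s.card - 1) * ∑ i ∈ s, |c i * a i| := by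
  induction h with
  | empty => simp
  | singleton i p hp => simpa using hp.error_le
  | cons i s hi hs y p z hy hp hz ih =>
    rw [Finset.sum_cons, Finset.sum_cons, Finset.card_cons]
    set t := ∑ i ∈ s, c i * a i
    set u := ∑ i ∈ s, |c i * a i|
    set d := c i * a i
    have htu : |t| ≤ u := Finset.abs_sum_le_sum_abs _ _
    have hp' := hp.error_le
    have hz' := hz.error_le
    have hsum : |y + p - (d + t)| ≤ ((1 + ε) ^ s.card - 1) * u + ε * |d| := by
      have : y + p - (d + t) = (y - t) + (p - d) := by ring
      rw [this]
      exact (abs_add_le _ _).trans (add_le_add ih hp')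
    have hyp : |y + p| ≤ |y + p - (d + t)| + (|d| + u) := by
      have h1 : |y + p| ≤ |y + p - (d + t)| + |d + t| := by
        simpa using abs_add_le (y + p - (d + t)) (d + t)
      linarith [abs_add_le d t]
    have hzd : |z - (d + t)| ≤ |z - (y + p)| + |y + p - (d + t)| := abs_sub_le _ _ _
    have h2 : ε * |y + p| ≤ ε * (((1 + ε) ^ s.card - 1) * u + ε * |d| + (|d| + u)) := by
      gcongr
      linarith
    -- The new term is rounded only twice; as `s` is nonempty, this fits into the exponent `s.card +
    -- 1`.
    have hpow : (1 + ε) ^ 1 ≤ (1 + ε) ^ s.card :=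
      pow_le_pow_right₀ (by linarith) hs.card_pos
    have hd : (1 + ε) * (1 + ε) * |d| ≤ (1 + ε) ^ s.card * (1 + ε) * |d| := by
      rw [pow_one] at hpow
      gcongr
    rw [pow_succ]
    linarith

open Classical in
/-- Error of a rounded linear combination whose arguments `a` approximate `a'`. -/
theorem IsFlLinComb.error_le {ι : Type} [Fintype ι] {ε : ℝ} (hε : 0 ≤ ε) {c a a' g : ι → ℝ}
    {y : ℝ} {m n : ℕ} (h : IsFlLinComb ε c a y)
    (hn : (Finset.univ.filter fun i => c i ≠ 0).card = n)
    (ha' : ∀ i, |a' i| ≤ g i)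
    (ha : ∀ i, c i ≠ 0 → |a i - a' i| ≤ ((1 + ε) ^ m - 1) * g i) :
    |y - ∑ i, c i * a' i| ≤ ((1 + ε) ^ (n + m) - 1) * ∑ i, |c i| * g i := by
  have h1 := IsFlSum.error_le hε h
  rw [hn] at h1
  have e1 : ∑ i ∈ Finset.univ.filter (fun i => c i ≠ 0), c i * a i = ∑ i, c i * a i := by
    refine Finset.sum_filter_of_ne fun i _ hi => left_ne_zero_of_mul hi
  have e2 : ∑ i ∈ Finset.univ.filter (fun i => c i ≠ 0), |c i * a i| = ∑ i, |c i * a i| := by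
    refine Finset.sum_filter_of_ne fun i _ hi => left_ne_zero_of_mul (abs_ne_zero.mp hi)
  have h1' : |y - ∑ i, c i * a i| ≤ ((1 + ε) ^ n - 1) * ∑ i, |c i * a i| := by
    rwa [e1, e2] at h1
  have hterm : ∀ i, |c i * a i - c i * a' i| ≤ ((1 + ε) ^ m - 1) * (|c i| * g i) := by
    intro i
    by_cases hc : c i = 0
    · simp [hc]
    · rw [← mul_sub, abs_mul]
      calc |c i| * |a i - a' i| ≤ |c i| * (((1 + ε) ^ m - 1) * g i) := by
            gcongr
            exact ha i hc
        _ = _ := by ring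
  have h2 : |∑ i, c i * a i - ∑ i, c i * a' i| ≤ ((1 + ε) ^ m - 1) * ∑ i, |c i| * g i := by
    rw [← Finset.sum_sub_distrib, Finset.mul_sum]
    exact (Finset.abs_sum_le_sum_abs _ _).trans (Finset.sum_le_sum fun i _ => hterm i)
  have h3 : ∑ i, |c i * a i| ≤ (1 + ε) ^ m * ∑ i, |c i| * g i := by
    rw [Finset.mul_sum]
    refine Finset.sum_le_sum fun i _ => ?_
    have h4 : |c i * a i| ≤ |c i * a i - c i * a' i| + |c i * a' i| := by
      simpa using abs_add_le (c i * a i - c i * a' i) (c i * a' i)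
    have h5 : |c i * a' i| ≤ |c i| * g i := by
      rw [abs_mul]
      gcongr
      exact ha' i
    linarith [hterm i]
  have h6 := mul_le_mul_of_nonneg_left h3 (sub_nonneg.mpr (one_le_one_add_pow hε n))
  have h7 := abs_sub_le y (∑ i, c i * a i) (∑ i, c i * a' i)
  -- The bounds telescope: `((1 + ε) ^ n - 1) * (1 + ε) ^ m + ((1 + ε) ^ m - 1) = (1 + ε) ^ (n + m)
  -- - 1`.
  rw [pow_add]
  linarith

/-- The product of approximations in terms of relative errors. -/
theorem abs_mul_sub_mul_le {s s' t t' x y p q : ℝ} (hp : 1 ≤ p)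
    (hs : |s - s'| ≤ (p - 1) * x) (ht : |t - t'| ≤ (q - 1) * y)
    (hs' : |s'| ≤ x) (ht' : |t'| ≤ y) :
    |s * t - s' * t'| ≤ (p * q - 1) * (x * y) := by
  have hx := (abs_nonneg _).trans hs'
  have hy := (abs_nonneg _).trans ht'
  -- Matches `(p - 1) * (q - 1) + (p - 1) + (q - 1) = p * q - 1`.
  have e : s * t - s' * t' = (s - s') * (t - t') + (s - s') * t' + s' * (t - t') := by ring
  have h1 : |(s - s') * (t - t')| ≤ ((p - 1) * x) * ((q - 1) * y) := by
    rw [abs_mul]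
    gcongr
  have h2 : |(s - s') * t'| ≤ ((p - 1) * x) * y := by
    rw [abs_mul]
    gcongr
  have h3 : |s' * (t - t')| ≤ x * ((q - 1) * y) := by
    rw [abs_mul]
    gcongr
  rw [e]
  linarith [abs_add_three ((s - s') * (t - t')) ((s - s') * t') (s' * (t - t'))]

/-! ### Bilinear rules -/

namespace Rule

theorem a_nonneg (f : Rule) (r : Fin f.R) : 0 ≤ f.a r := Finset.sum_nonneg fun _ _ => abs_nonneg _

theorem b_nonneg (f : Rule) (r : Fin f.R) : 0 ≤ f.b r := Finset.sum_nonneg fun _ _ => abs_nonneg _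

theorem e_le_E (f : Rule) (k : Fin f.M₀ × Fin f.N₀) : f.e k ≤ f.E :=
  le_ciSup (Set.finite_range f.e).bddAbove k

open Classical in
theorem gamma_add_le_Q (f : Rule) (k : Fin f.M₀ × Fin f.N₀) :
    f.gamma k + (Finset.univ.sup fun r =>
      (f.alpha r + f.beta r) * (if f.W k r ≠ 0 then 1 else 0)) ≤ f.Q :=
  Finset.le_sup (f := f.q) (Finset.mem_univ k)

/-- Applied to all-ones matrices, the rule writes `K₀` as a sum that the triangle inequality bounds
by `e_k`. -/
theorem K₀_le_E {f : Rule} (hf : f.ComputesProduct) : (f.K₀ : ℝ) ≤ f.E := by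
  let k : Fin f.M₀ × Fin f.N₀ := (⟨0, f.M₀_pos⟩, ⟨0, f.N₀_pos⟩)
  refine le_trans ?_ (f.e_le_E k)
  have h := hf (Matrix.of fun _ _ => 1) (Matrix.of fun _ _ => 1) k
  simp only [Matrix.mul_apply, Matrix.of_apply, mul_one, Finset.sum_const, Finset.card_univ, Fintype.card_fin,
    nsmul_eq_mul] at h
  rw [h]
  refine Finset.sum_le_sum fun r _ => (le_abs_self _).trans ?_
  rw [abs_mul, abs_mul, mul_comm]
  have h1 : |∑ i, f.U i r| ≤ f.a r := Finset.abs_sum_le_sum_abs _ _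
  have h2 : |∑ i, f.V i r| ≤ f.b r := Finset.abs_sum_le_sum_abs _ _
  have := f.a_nonneg r
  gcongr

end Rule

/-! ### Blocks -/

theorem blockIdx_bijective {n n₀ : ℕ} (h : n₀ ∣ n) :
    Function.Bijective fun p : Fin n₀ × Fin (n / n₀) => blockIdx p.1 p.2 := by
  rw [Fintype.bijective_iff_injective_and_card]
  constructor
  · rintro ⟨i, p⟩ ⟨j, q⟩ hpq
    have hv : (i : ℕ) * (n / n₀) + p = j * (n / n₀) + q := congrArg Fin.val hpq
    have hpos : 0 < n / n₀ := (Nat.zero_le _).trans_lt p.2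
    have hi : (i : ℕ) = j := by
      have h1 := congrArg (· / (n / n₀)) hv
      simpa [Nat.add_comm, Nat.add_mul_div_right _ _ hpos, Nat.div_eq_of_lt p.2,
        Nat.div_eq_of_lt q.2] using h1
    rw [hi] at hv
    exact Prod.ext (Fin.ext hi) (Fin.ext (Nat.add_left_cancel hv))
  · simp [Nat.mul_div_cancel' h]

/-- Splitting the inner index into block number and position `z` reduces this to the scalar rule:
for fixed `x`, `y`, `z`, the corresponding entries of the blocks form an `M₀ × K₀` and a `K₀ × N₀`
matrix. -/
theorem block_mul {f : Rule} (hf : f.ComputesProduct) {M K N : ℕ} (hK : f.K₀ ∣ K)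
    (A : Matrix (Fin M) (Fin K) ℝ) (B : Matrix (Fin K) (Fin N) ℝ)
    (k : Fin f.M₀ × Fin f.N₀) (x : Fin (M / f.M₀)) (y : Fin (N / f.N₀)) :
    block (A * B) k x y =
      ∑ r, f.W k r * ∑ z, (∑ i, f.U i r * block A i x z) * (∑ j, f.V j r * block B j z y) := by
  simp only [Finset.mul_sum (s := (Finset.univ : Finset (Fin (K / f.K₀))))]
  rw [Finset.sum_comm]
  simp only [block, Matrix.mul_apply]
  rw [← (blockIdx_bijective hK).sum_comp, Fintype.sum_prod_type_right]
  refine Finset.sum_congr rfl fun z _ => ?_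
  exact hf (fun i j => A (blockIdx i x) (blockIdx j z)) (fun i j => B (blockIdx i z) (blockIdx j y)) k

/-! ### Error of the recursive algorithm -/

open Classical in
theorem card_filter_eq_sum {ι : Type} [Fintype ι] (c : ι → ℝ) :
    (Finset.univ.filter fun i => c i ≠ 0).card =
      ∑ i, (if c i ≠ 0 then 1 else 0) := Finset.card_filter _ _

theorem K_div_le {L : ℕ} {alg : Fin L → Rule} (halg : ∀ l, (alg l).ComputesProduct) {K : ℕ}
    (hK : (∏ l, (alg l).K₀) ∣ K) :
    (K : ℝ) ≤ (K / ∏ l, (alg l).K₀ : ℕ) * ∏ l, (alg l).E := by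
  calc (K : ℝ) = (K / ∏ l, (alg l).K₀ : ℕ) * ∏ l, ((alg l).K₀ : ℝ) := by
        rw [← Nat.cast_prod, ← Nat.cast_mul, Nat.div_mul_cancel hK]
    _ ≤ _ := by
        gcongr with l
        exact Rule.K₀_le_E (halg l)

theorem dvd_div_of_prod_succ_dvd {L n : ℕ} (g : Fin (L + 1) → ℕ)
    (h : (∏ l, g l) ∣ n) : g 0 ∣ n ∧ (∏ l : Fin L, g l.succ) ∣ n / g 0 := by
  rw [Fin.prod_univ_succ] at h
  have h0 := dvd_of_mul_right_dvd h
  exact ⟨h0, (Nat.dvd_div_iff_mul_dvd h0).mpr h⟩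

theorem abs_dot_sub_dot_le {n : ℕ} {s s' t t' : Fin n → ℝ} {x y p q : ℝ} (hp : 1 ≤ p)
    (hs : ∀ z, |s z - s' z| ≤ (p - 1) * x) (ht : ∀ z, |t z - t' z| ≤ (q - 1) * y)
    (hs' : ∀ z, |s' z| ≤ x) (ht' : ∀ z, |t' z| ≤ y) :
    |∑ z, s z * t z - ∑ z, s' z * t' z| ≤ n * ((p * q - 1) * (x * y)) := by
  rw [← Finset.sum_sub_distrib]
  refine (Finset.abs_sum_le_sum_abs _ _).trans ?_
  refine (Finset.sum_le_card_nsmul _ _ _ fun z _ =>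
    abs_mul_sub_mul_le hp (hs z) (ht z) (hs' z) (ht' z)).trans ?_
  simp

theorem abs_dot_le {n : ℕ} {s t : Fin n → ℝ} {x y : ℝ}
    (hs : ∀ z, |s z| ≤ x) (ht : ∀ z, |t z| ≤ y) : |∑ z, s z * t z| ≤ n * (x * y) := by
  refine (Finset.abs_sum_le_sum_abs _ _).trans ?_
  refine (Finset.sum_le_card_nsmul _ _ (x * y) fun z _ => ?_).trans (by simp)
  rw [abs_mul]
  exact mul_le_mul (hs z) (ht z) (abs_nonneg _) ((abs_nonneg _).trans (hs z))

theorem IsFlClassicalMul.error_le {ε : ℝ} (hε : 0 ≤ ε) {M K N : ℕ}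
    {A : Matrix (Fin M) (Fin K) ℝ} {B : Matrix (Fin K) (Fin N) ℝ} {C : Matrix (Fin M) (Fin N) ℝ}
    (h : IsFlClassicalMul ε A B C) {x y : ℝ} (hA : ∀ i j, |A i j| ≤ x) (hB : ∀ i j, |B i j| ≤ y)
    (i : Fin M) (j : Fin N) :
    |C i j - (A * B) i j| ≤ ((1 + ε) ^ K - 1) * (K * (x * y)) := by
  have h1 := (h i j).error_le hε
  rw [Finset.card_univ, Fintype.card_fin] at h1
  rw [Matrix.mul_apply]
  refine h1.trans ?_
  have := one_le_one_add_pow hε K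
  refine mul_le_mul_of_nonneg_left ?_ (sub_nonneg.mpr this)
  refine (Finset.sum_le_card_nsmul _ _ (x * y) fun z _ => ?_).trans (by simp)
  rw [abs_mul]
  exact mul_le_mul (hA i z) (hB z j) (abs_nonneg _) ((abs_nonneg _).trans (hA i z))

open Classical in
/-- Error of a rounded linear combination of exact, bounded arguments. -/
theorem IsFlLinComb.error_le_of_bound {ι : Type} [Fintype ι] {ε : ℝ} (hε : 0 ≤ ε) {c a : ι → ℝ}
    {y x : ℝ} (h : IsFlLinComb ε c a y) (ha : ∀ i, |a i| ≤ x) :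
    |y - ∑ i, c i * a i| ≤
      ((1 + ε) ^ (∑ i, (if c i ≠ 0 then 1 else 0)) - 1) *
        ((∑ i, |c i|) * x) := by
  have := h.error_le hε (m := 0) (a' := a) (g := fun _ => x) (card_filter_eq_sum c) ha (by simp)
  rwa [add_zero, ← Finset.sum_mul] at this

theorem abs_linComb_le {ι : Type} [Fintype ι] {c a : ι → ℝ} {x : ℝ} (ha : ∀ i, |a i| ≤ x) :
    |∑ i, c i * a i| ≤ (∑ i, |c i|) * x := by
  rw [Finset.sum_mul]
  refine (Finset.abs_sum_le_sum_abs _ _).trans (Finset.sum_le_sum fun i _ => ?_)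
  rw [abs_mul]
  gcongr
  exact ha i

open Classical in
/-- Entrywise error bound for the recursive algorithm, to all orders in `ε`. -/
theorem IsComputed.error_le {ε : ℝ} (hε : 0 ≤ ε) :
    ∀ {L : ℕ} {alg : Fin L → Rule}, (∀ l, (alg l).ComputesProduct) →
    ∀ {M K N : ℕ}, (∏ l, (alg l).M₀) ∣ M → (∏ l, (alg l).K₀) ∣ K → (∏ l, (alg l).N₀) ∣ N →
    ∀ {A : Matrix (Fin M) (Fin K) ℝ} {B : Matrix (Fin K) (Fin N) ℝ} {C : Matrix (Fin M) (Fin N) ℝ},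
    IsComputed ε L alg M K N A B C →
    ∀ {x y : ℝ}, 0 ≤ x → 0 ≤ y → (∀ i j, |A i j| ≤ x) → (∀ i j, |B i j| ≤ y) → ∀ i j,
    |C i j - (A * B) i j| ≤ ((1 + ε) ^ (K / ∏ l, (alg l).K₀ + ∑ l, (alg l).Q) - 1) *
      ((K / ∏ l, (alg l).K₀ : ℕ) * (∏ l, (alg l).E) * (x * y)) := by
  intro L
  induction L with
  | zero =>
    intro alg _ M K N _ _ _ A B C hC x y _ _ hA hB i j
    simpa using IsFlClassicalMul.error_le hε hC hA hB i j
  | succ L ih =>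
    intro alg halg M K N hM hK hN A B C hC x y hx hy hA hB i j
    obtain ⟨S, T, P, hS, hT, hP, hW⟩ := hC
    obtain ⟨hM0, hM'⟩ := dvd_div_of_prod_succ_dvd _ hM
    obtain ⟨hK0, hK'⟩ := dvd_div_of_prod_succ_dvd _ hK
    obtain ⟨hN0, hN'⟩ := dvd_div_of_prod_succ_dvd _ hN
    have halg' : ∀ l : Fin L, (alg l.succ).ComputesProduct := fun l => halg _
    rw [Fin.prod_univ_succ, Fin.prod_univ_succ, Fin.sum_univ_succ, ← Nat.div_div_eq_div_mul]
    have hKF := K_div_le halg' hK'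
    set κ := K / (alg 0).K₀ / ∏ l : Fin L, (alg l.succ).K₀ with hκ
    set F := (κ : ℝ) * ∏ l : Fin L, (alg l.succ).E with hF
    set D := κ + ∑ l : Fin L, (alg l.succ).Q with hD
    have hF0 : 0 ≤ F := (Nat.cast_nonneg _).trans hKF
    obtain ⟨⟨k₁, p⟩, rfl⟩ := (blockIdx_bijective hM0).surjective i
    obtain ⟨⟨k₂, q⟩, rfl⟩ := (blockIdx_bijective hN0).surjective j
    have hSd : ∀ r u v, |S r u v - ∑ i, (alg 0).U i r * block A i u v| ≤
        ((1 + ε) ^ (alg 0).alpha r - 1) * ((alg 0).a r * x) := fun r u v =>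
      (hS r u v).error_le_of_bound hε fun i => hA _ _
    have hTd : ∀ r u v, |T r u v - ∑ i, (alg 0).V i r * block B i u v| ≤
        ((1 + ε) ^ (alg 0).beta r - 1) * ((alg 0).b r * y) := fun r u v =>
      (hT r u v).error_le_of_bound hε fun i => hB _ _
    have hSe : ∀ r u v, |∑ i, (alg 0).U i r * block A i u v| ≤ (alg 0).a r * x := fun r u v =>
      abs_linComb_le fun i => hA _ _
    have hTe : ∀ r u v, |∑ i, (alg 0).V i r * block B i u v| ≤ (alg 0).b r * y := fun r u v =>
      abs_linComb_le fun i => hB _ _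
    have hPe : ∀ r, |∑ z, (∑ i, (alg 0).U i r * block A i p z) *
        (∑ i, (alg 0).V i r * block B i z q)| ≤ F * ((alg 0).a r * x * ((alg 0).b r * y)) := by
      intro r
      have := (alg 0).a_nonneg r
      have := (alg 0).b_nonneg r
      refine (abs_dot_le (hSe r p) fun z => hTe r z q).trans ?_
      gcongr
    have hPd : ∀ r, |P r p q - ∑ z, (∑ i, (alg 0).U i r * block A i p z) *
        (∑ i, (alg 0).V i r * block B i z q)| ≤
        ((1 + ε) ^ ((alg 0).alpha r + (alg 0).beta r + D) - 1) *
          (F * ((alg 0).a r * x * ((alg 0).b r * y))) := by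
      intro r
      have ha := mul_nonneg ((alg 0).a_nonneg r) hx
      have hb := mul_nonneg ((alg 0).b_nonneg r) hy
      have hα := one_le_one_add_pow hε ((alg 0).alpha r)
      have hβ := one_le_one_add_pow hε ((alg 0).beta r)
      -- The recursive call multiplies the rounded factors, so their entry bounds carry the extra
      -- powers of `1 + ε`.
      have h1 := ih halg' hM' hK' hN' (hP r)
        (x := (1 + ε) ^ (alg 0).alpha r * ((alg 0).a r * x))
        (y := (1 + ε) ^ (alg 0).beta r * ((alg 0).b r * y)) (by positivity) (by positivity)
        (fun u v => by
          have := abs_add_le (S r u v - ∑ i, (alg 0).U i r * block A i u v)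
            (∑ i, (alg 0).U i r * block A i u v)
          rw [sub_add_cancel] at this
          linarith [hSd r u v, hSe r u v])
        (fun u v => by
          have := abs_add_le (T r u v - ∑ i, (alg 0).V i r * block B i u v)
            (∑ i, (alg 0).V i r * block B i u v)
          rw [sub_add_cancel] at this
          linarith [hTd r u v, hTe r u v]) p q
      rw [Matrix.mul_apply] at h1
      have h2 := abs_dot_sub_dot_le hα (hSd r p) (fun z => hTd r z q) (hSe r p)
        (fun z => hTe r z q)
      have h3 := abs_sub_le (P r p q) (∑ z, S r p z * T r z q)
        (∑ z, (∑ i, (alg 0).U i r * block A i p z) * (∑ i, (alg 0).V i r * block B i z q))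
      have h4 : ((1 + ε) ^ (alg 0).alpha r * (1 + ε) ^ (alg 0).beta r - 1) *
          ((alg 0).a r * x * ((alg 0).b r * y)) ≥ 0 :=
        mul_nonneg (by nlinarith) (by positivity)
      -- Replacing the inner dimension by `F` gives both errors the same factor; then `p * (d - 1) +
      -- (p - 1) = p * d - 1`, with `p = (1 + ε) ^ (α_r + β_r)` and `d = (1 + ε) ^ D`.
      have h5 := mul_le_mul_of_nonneg_right hKF h4
      rw [pow_add, pow_add]
      linarith
    set μ := Finset.univ.sup fun r => ((alg 0).alpha r + (alg 0).beta r) *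
      (if (alg 0).W (k₁, k₂) r ≠ 0 then 1 else 0) with hμ
    -- Only products with nonzero weight need an error bound, so the maximum `μ` over those `r`
    -- suffices.
    have hmain := (hW (k₁, k₂) p q).error_le hε (m := μ + D) (card_filter_eq_sum _) hPe
      (fun r hr => by
        refine (hPd r).trans ?_
        have := (alg 0).a_nonneg r
        have := (alg 0).b_nonneg r
        have hle : (alg 0).alpha r + (alg 0).beta r ≤ μ := by
          have := Finset.le_sup (f := fun r => ((alg 0).alpha r + (alg 0).beta r) *
            (if (alg 0).W (k₁, k₂) r ≠ 0 then 1 else 0))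
            (Finset.mem_univ r)
          simpa only [if_pos hr, mul_one] using this
        gcongr
        linarith)
    rw [← block_mul (halg 0) hK0] at hmain
    refine hmain.trans ?_
    change ((1 + ε) ^ ((alg 0).gamma (k₁, k₂) + (μ + D)) - 1) * _ ≤ _
    have hsum : ∑ r, |(alg 0).W (k₁, k₂) r| * (F * ((alg 0).a r * x * ((alg 0).b r * y))) =
        F * (alg 0).e (k₁, k₂) * (x * y) := by
      rw [Rule.e, Finset.mul_sum, Finset.sum_mul]
      exact Finset.sum_congr rfl fun r _ => by ring
    have hE := (alg 0).e_le_E (k₁, k₂)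
    have hE0 : 0 ≤ (alg 0).E := (Nat.cast_nonneg _).trans (Rule.K₀_le_E (halg 0))
    have hQ := (alg 0).gamma_add_le_Q (k₁, k₂)
    have hexp : (alg 0).gamma (k₁, k₂) + (μ + D) ≤
        κ + ((alg 0).Q + ∑ l : Fin L, (alg l.succ).Q) := by
      rw [← hμ] at hQ
      omega
    have hone := one_le_one_add_pow hε (κ + ((alg 0).Q + ∑ l : Fin L, (alg l.succ).Q))
    rw [hsum, mul_comm (alg 0).E, ← mul_assoc (κ : ℝ)]
    calc ((1 + ε) ^ ((alg 0).gamma (k₁, k₂) + (μ + D)) - 1) * (F * (alg 0).e (k₁, k₂) * (x * y))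
        ≤ ((1 + ε) ^ (κ + ((alg 0).Q + ∑ l : Fin L, (alg l.succ).Q)) - 1) *
          (F * (alg 0).E * (x * y)) := by
          have he : 0 ≤ (alg 0).e (k₁, k₂) := Finset.sum_nonneg fun r _ =>
            mul_nonneg (mul_nonneg ((alg 0).a_nonneg r) ((alg 0).b_nonneg r)) (abs_nonneg _)
          gcongr
          linarith

/-! ### First-order form of the bound -/

theorem one_add_pow_sub_one_le {ε : ℝ} (hε : 0 ≤ ε) (hε1 : ε ≤ 1) (n : ℕ) :
    (1 + ε) ^ n - 1 ≤ n * ε + 2 ^ n * ε ^ 2 := by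
  induction n with
  | zero => simpa using sq_nonneg ε
  | succ n ih =>
    have hn : (n : ℝ) ≤ 2 ^ n := by exact_mod_cast Nat.lt_two_pow_self.le
    -- The increment is `(1 + ε) ^ n * ε = ε + ((1 + ε) ^ n - 1) * ε`; this crude bound makes its
    -- last part at most `2 ^ n * ε ^ 2`, doubling the remainder.
    have h1 : ((1 + ε) ^ n - 1) ≤ 2 ^ n * ε := by
      clear ih hn
      induction n with
      | zero => simpa using hε
      | succ n ih =>
        have h2 : (1 + ε) ^ n ≤ 2 ^ n := by
          gcongr
          linarith
        rw [pow_succ, pow_succ]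
        have := mul_le_mul_of_nonneg_right h2 hε
        linarith
    have := mul_le_mul_of_nonneg_right h1 hε
    rw [pow_succ, pow_succ]
    push_cast
    linarith

end FastMM

theorem theorem4p2 (L : ℕ) (alg : Fin L → FastMM.Rule)
    (halg : ∀ l, (alg l).ComputesProduct)
    (M K N : ℕ)
    (hM : (∏ l, (alg l).M₀) ∣ M) (hK : (∏ l, (alg l).K₀) ∣ K) (hN : (∏ l, (alg l).N₀) ∣ N) :
    ∃ c : ℝ, ∀ ε : ℝ, 0 < ε → ε < 1 →
      ∀ (A : Matrix (Fin M) (Fin K) ℝ) (B : Matrix (Fin K) (Fin N) ℝ)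
        (C' : Matrix (Fin M) (Fin N) ℝ),
        FastMM.IsComputed ε L alg M K N A B C' →
        ‖C' - A * B‖ ≤
          ((K : ℝ) / (∏ l, ((alg l).K₀ : ℝ)) + ∑ l, ((alg l).Q : ℝ)) *
            ((K : ℝ) / (∏ l, ((alg l).K₀ : ℝ))) * (∏ l, (alg l).E) * ‖A‖ * ‖B‖ * ε
          + c * ‖A‖ * ‖B‖ * ε ^ 2 := by
  have hcast : (K : ℝ) / (∏ l, ((alg l).K₀ : ℝ)) = (K / ∏ l, (alg l).K₀ : ℕ) := by
    rw [Nat.cast_div hK, Nat.cast_prod]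
    exact_mod_cast (Finset.prod_pos fun l _ => (alg l).K₀_pos).ne'
  rw [hcast]
  set κ := K / ∏ l, (alg l).K₀ with hκ
  have hF : (0 : ℝ) ≤ κ * ∏ l, (alg l).E := (Nat.cast_nonneg _).trans (FastMM.K_div_le halg hK)
  -- The constant is the quadratic remainder `2 ^ n` for the full exponent `n`, times the magnitude
  -- factor.
  refine ⟨2 ^ (κ + ∑ l, (alg l).Q) * (κ * ∏ l, (alg l).E), fun ε hε hε1 A B C' h => ?_⟩
  have hbound : ∀ i j, |C' i j - (A * B) i j| ≤ ((1 + ε) ^ (κ + ∑ l, (alg l).Q) - 1) *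
      (κ * (∏ l, (alg l).E) * (‖A‖ * ‖B‖)) :=
    h.error_le hε.le halg hM hK hN (norm_nonneg A) (norm_nonneg B)
      (fun i j => A.norm_entry_le_entrywise_sup_norm)
      (fun i j => B.norm_entry_le_entrywise_sup_norm)
  have hFn : 0 ≤ κ * (∏ l, (alg l).E) * (‖A‖ * ‖B‖) := by positivity
  have hpow := FastMM.one_add_pow_sub_one_le hε.le hε1.le (κ + ∑ l, (alg l).Q)
  have hone := FastMM.one_le_one_add_pow hε.le (κ + ∑ l, (alg l).Q)
  have hnorm : ‖C' - A * B‖ ≤ ((1 + ε) ^ (κ + ∑ l, (alg l).Q) - 1) *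
      (κ * (∏ l, (alg l).E) * (‖A‖ * ‖B‖)) :=
    (Matrix.norm_le_iff (mul_nonneg (by linarith) hFn)).mpr fun i j => hbound i j
  refine hnorm.trans ((mul_le_mul_of_nonneg_right hpow hFn).trans (le_of_eq ?_))
  push_cast
  ring
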